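/- Let $K$ be an algebraically closed field of characteristic $0$ (for example $K=\mathbb C$). For an $n\times N$ matrix $M$ over $K$, let $\operatorname{per}(M)$ be the sum of all products of $n$ entries of $M$ such that no two of them lie in the same row or in the same column. For polynomials $P,Q\in K[y]$ with zeros $x_1,\dots,x_n$ and $y_1,\dots,y_N$ (listed with multiplicity), put $$\operatorname{PER}(P,Q)=\operatorname{per}\Bigl(\frac1{x_i-y_j}\Bigr)_{1\le i\le n,\ 1\le j\le N}.$$ For $\alpha\in K$ write $(\alpha)_k=\alpha(\alpha+1)\cdots(\alpha+k-1)$ for $k\ge1$, and $(\alpha)_0=1$. Let $n$, $m$, $r$ be positive integers, $d=\gcd(n,r)$, let $a_0,\dots,a_m,b_0,\dots,b_m\in K$, and put $$Q(y)=\sum_{\ell=0}^m a_\ell y^{\ell n}+\sum_{\ell=0}^m b_\ell y^{\ell n+r},\qquad A=\sum_{\ell=0}^m a_\ell,\qquad B=\sum_{\ell=0}^m b_\ell .$$ Suppose that $x^n-1$ and $Q$ have no common zero, i.e. $Q(z)\neq0$ for every $z\in K$ with $z^n=1$. Then $\bigl(A^{n/d}-(-B)^{n/d}\bigr)^d\neq0$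 and $$\operatorname{PER}(x^n-1,Q)=-\frac{\displaystyle d^n\prod_{i=1}^d\left(A^{n/d}\left(\frac{\sum_{\ell=0}^m(i-n\ell-1)a_\ell}{\sum_{\ell=0}^m d\,a_\ell}\right)_{n/d}-(-B)^{n/d}\left(\frac{\sum_{\ell=0}^m(i-r-n\ell-1)b_\ell}{\sum_{\ell=0}^m d\,b_\ell}\right)_{n/d}\right)}{\bigl(A^{n/d}-(-B)^{n/d}\bigr)^d}.$$ This holds as written if $A\ne0$ and $B\ne0$, and also if all $a_\ell$ vanish or all $b_\ell$ vanish, the corresponding term in each factor then being $0$. In general (also when $A=0$ or $B=0$) it holds with the denominators inside the shifted factorials cleared, that is, $$\operatorname{PER}(x^n-1,Q)=-\frac{\displaystyle\prod_{i=1}^d\left(\prod_{j=0}^{n/d-1}\Bigl(\sum_{\ell=0}^m(i-n\ell-1)a_\ell+j\,d\,A\Bigr)-(-1)^{n/d}\prod_{j=0}^{n/d-1}\Bigl(\sum_{\ell=0}^m(i-r-n\ell-1)b_\ell+j\,d\,B\Bigr)\right)}{\bigl(A^{n/d}-(-B)^{n/d}\bigr)^d}.$$ -/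

import Mathlib

open Polynomial

/-- The permanent of a (not necessarily square) matrix: the sum of all products of entries, one
entry from each row, such that no two of them lie in the same column. -/
noncomputable def rectPermanent {ι κ K : Type*} [Fintype ι] [Fintype κ] [CommSemiring K]
    (A : Matrix ι κ K) : K :=
  open Classical in ∑ f : ι ↪ κ, ∏ i, A i (f i)

/-- The Scott-type permanent `PER(P, Q) = per (1 / (x_i - y_j))`, where the `x_i` are the zeros
of `P` and the `y_j` are the zeros of `Q`, both listed with multiplicity: rows and columns are
indexed by the elements of the multisets `P.roots` and `Q.roots`. -/
noncomputable def scottPermanent {K : Type*} [Field K] (P Q : K[X]) : K :=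
  open Classical in
  rectPermanent (Matrix.of fun (x : P.roots) (y : Q.roots) => 1 / (x.1 - y.1))

/-- The polynomial `∑_{ℓ=0}^m a_ℓ y^{ℓ n} + ∑_{ℓ=0}^m b_ℓ y^{ℓ n + r}`. -/
noncomputable def twoClassPoly {K : Type*} [Field K] (n m r : ℕ) (a b : ℕ → K) : K[X] :=
  ∑ l ∈ Finset.range (m + 1), C (a l) * X ^ (l * n) +
    ∑ l ∈ Finset.range (m + 1), C (b l) * X ^ (l * n + r)

/-- The shifted factorial `(α)_k = α (α + 1) ⋯ (α + k - 1)`, with `(α)_0 = 1`. -/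
def shiftedFactorial {K : Type*} [Field K] (α : K) (k : ℕ) : K :=
  ∏ j ∈ Finset.range k, (α + (j : K))

/-! ### Expansion of a permanent along one column -/

section RectPermanent

variable {ι κ K : Type*}

/-! For distinct `x_i`, the permanent of `1 / (x_i - y_j)` is a determinant in which the `y_j` enter
only through `q_i = ∑_j 1 / (x_i - y_j) = Q'(x_i) / Q(x_i)`: it equals `(scottMatrix x q).det`
(`rectPermanent_inv_sub_eq_det`). Both sides obey the same recursion when a column is added
(`rectPermanent_option`, `det_scottMatrix_add_inv`).

When the `x_i` are the `n`-th roots of unity, the matrix acts simply on monomials: it sends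
`x^(k+1)` to `q x^(k+1) - k x^k` for `0 ≤ k < n` (`scottMatrix_rootOfUnityVal_sum`). On these points
`Q` reduces to `A + B x^r`, and `x Q' - k Q` reduces to `α_k + β_k x^r`. Hence, after the column
scaling `diag(x)`, the matrix becomes `1 / Q` times the map `x^k ↦ α_k x^k + β_k x^(k+r)`. Adding
`r` splits the exponents modulo `n` into `d` cycles of length `e = n / d`, and a cycle contributes
`∏ α - (-1)^e ∏ β` (`det_eq_of_monomial_action`). The same lemma, applied to multiplication by `A +
B x^r`, evaluates the denominator `∏ Q(x_g)`. -/

theorem rectPermanent_reindex [Fintype ι] [Fintype κ] [CommSemiring K] {ι' κ' : Type*} [Fintype ι'] [Fintype κ']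
    (e : ι ≃ ι') (f : κ ≃ κ') (A : Matrix ι κ K) :
    rectPermanent (Matrix.reindex e f A) = rectPermanent A := by
  classical
  unfold rectPermanent
  symm
  refine Fintype.sum_equiv (Equiv.embeddingCongr e f) _ _ fun g => ?_
  refine Fintype.prod_equiv e _ _ fun i => ?_
  simp

/-- An embedding into `Option κ` either avoids `none` or takes it at exactly one point. -/
def optionCodomainEmbedding [DecidableEq ι] :
    (ι ↪ κ) ⊕ (Σ i : ι, ({j // j ≠ i} ↪ κ)) → (ι ↪ Option κ)
  | .inl f => f.trans Function.Embedding.some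
  | .inr ⟨i, f⟩ =>
    { toFun := fun j => if h : j = i then none else some (f ⟨j, h⟩)
      inj' := by
        intro j k hjk
        by_cases hj : j = i <;> by_cases hk : k = i <;> simp_all }

theorem optionCodomainEmbedding_bijective [DecidableEq ι] :
    Function.Bijective (optionCodomainEmbedding (ι := ι) (κ := κ)) := by
  constructor
  · rintro (f | ⟨i, f⟩) (g | ⟨k, g⟩) h
    · congr 1
      ext j
      have := DFunLike.congr_fun h j
      simpa [optionCodomainEmbedding] using this
    · have := DFunLike.congr_fun h k
      simp [optionCodomainEmbedding] at this
    · have := DFunLike.congr_fun h i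
      simp [optionCodomainEmbedding] at this
    · have hik : i = k := by
        have := DFunLike.congr_fun h i
        by_contra hne
        simp [optionCodomainEmbedding, hne] at this
      subst hik
      congr 2
      ext ⟨j, hj⟩
      have := DFunLike.congr_fun h j
      simpa [optionCodomainEmbedding, hj] using this
  · intro g
    by_cases h : ∃ i, g i = none
    · obtain ⟨i, hi⟩ := h
      have hne : ∀ j : {j // j ≠ i}, (g j).isSome := by
        rintro ⟨j, hj⟩
        rw [Option.isSome_iff_ne_none]
        intro h0
        exact hj (g.injective (h0.trans hi.symm))
      refine ⟨.inr ⟨i, ⟨fun j => (g j).get (hne j), ?_⟩⟩, ?_⟩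
      · intro j k hjk
        have : g j = g k := Option.get_inj.mp hjk
        exact Subtype.ext (g.injective this)
      · ext1 j
        by_cases hj : j = i
        · subst hj
          simp [optionCodomainEmbedding, hi]
        · exact (dif_neg hj).trans (Option.some_get _)
    · push Not at h
      have hne : ∀ j, (g j).isSome := fun j => Option.isSome_iff_ne_none.2 (h j)
      refine ⟨.inl ⟨fun j => (g j).get (hne j), ?_⟩, ?_⟩
      · intro j k hjk
        exact g.injective (Option.get_inj.mp hjk)
      · ext1 j
        exact Option.some_get _

/-- The new column is either unused or used by exactly one row `i`, which is then deleted along with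
it. -/
theorem rectPermanent_option [Fintype ι] [Fintype κ] [DecidableEq ι] [CommSemiring K] (A : Matrix ι (Option κ) K) :
    rectPermanent A = rectPermanent (A.submatrix id some) +
      ∑ i, A i none * rectPermanent (A.submatrix (Subtype.val : {j // j ≠ i} → ι) some) := by
  classical
  unfold rectPermanent
  rw [← Fintype.sum_bijective _ optionCodomainEmbedding_bijective _ _ (fun _ => rfl),
    Fintype.sum_sum_type]
  congr 1
  · rw [← Finset.univ_sigma_univ, Finset.sum_sigma]
    refine Finset.sum_congr rfl fun i _ => ?_
    rw [Finset.mul_sum]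
    refine Finset.sum_congr (by congr!) fun f _ => ?_
    rw [← Finset.mul_prod_erase _ _ (Finset.mem_univ i)]
    congr 1
    · simp [optionCodomainEmbedding]
    · rw [Finset.prod_subtype (p := fun j => j ≠ i) (s := Finset.univ.erase i) (by simp)
        (fun j => A j (optionCodomainEmbedding (Sum.inr ⟨i, f⟩) j))]
      refine Finset.prod_congr rfl ?_
      rintro ⟨j, hj⟩ _
      simp [optionCodomainEmbedding, hj]

end RectPermanent

/-! ### Determinant of a rank-one update -/

section DetRankOne

variable {ι K : Type*} [Fintype ι] [DecidableEq ι] [CommRing K]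

/-- The update is made one row at a time, by linearity in that row; no invertibility of `M` is
needed. -/
theorem Matrix.det_add_vecMulVec_eq_sum_updateRow (M : Matrix ι ι K) (u v : ι → K) :
    (M + Matrix.vecMulVec u v).det = M.det + ∑ i, u i * (M.updateRow i v).det := by
  suffices h : ∀ s : Finset ι,
      (Matrix.of fun i j => M i j + if i ∈ s then u i * v j else 0).det =
        M.det + ∑ i ∈ s, u i * (M.updateRow i v).det by
    rw [← h Finset.univ]
    congr 1
    ext i j
    simp [Matrix.vecMulVec_apply]
  intro s
  induction s using Finset.induction_on with
  | empty => simp; rfl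
  | insert k s hk ih =>
    set N : Matrix ι ι K := Matrix.of fun i j => M i j + if i ∈ s then u i * v j else 0 with hN
    have h1 : (Matrix.of fun i j => M i j + if i ∈ insert k s then u i * v j else 0) =
        N.updateRow k (N k + u k • v) := by
      ext i j
      by_cases hi : i = k
      · subst hi
        simp [hN, hk]
      · simp [hN, hi]
    -- The rows of `N` differ from those of `M` by multiples of `v`, which row `k`, now equal to
    -- `v`, clears.
    have h2 : (N.updateRow k v).det = (M.updateRow k v).det := by
      refine Matrix.det_eq_of_forall_row_eq_smul_add_const
        (fun i => if i ∈ s then u i else 0) k (by simp [hk]) fun i j => ?_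
      by_cases hi : i = k
      · subst hi
        simp [hk]
      · by_cases his : i ∈ s <;> simp [hN, hi, his]
    rw [h1, Matrix.det_updateRow_add, Matrix.updateRow_eq_self, Matrix.det_updateRow_smul, ih, h2,
      Finset.sum_insert hk]
    ring

end DetRankOne

/-! ### The column recursion on the determinant side -/

section ScottMatrix

variable {ι K : Type*} [Fintype ι] [DecidableEq ι] [Field K]

/-- The matrix with off-diagonal entries `-1 / (x_i - x_j)` and diagonal entries
`q_i - ∑_{k ≠ i} 1 / (x_i - x_k)`. The term `k = i` of the sum is `0⁻¹ = 0`. -/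
def scottMatrix (x q : ι → K) : Matrix ι ι K :=
  Matrix.diagonal (fun i => q i - ∑ k, (x i - x k)⁻¹) - Matrix.of fun i j => (x i - x j)⁻¹

theorem scottMatrix_apply_self (x q : ι → K) (i : ι) :
    scottMatrix x q i i = q i - ∑ k, (x i - x k)⁻¹ := by
  simp [scottMatrix]

theorem scottMatrix_apply_ne (x q : ι → K) {i j : ι} (h : i ≠ j) :
    scottMatrix x q i j = -(x i - x j)⁻¹ := by
  simp [scottMatrix, h]

/-- The columns of the matrix with `q = 0` sum to zero. -/
theorem det_scottMatrix_zero [Nonempty ι] (x : ι → K) :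
    (scottMatrix x 0).det = 0 := by
  rw [← Matrix.exists_vecMul_eq_zero_iff]
  refine ⟨1, one_ne_zero, ?_⟩
  ext j
  simp only [scottMatrix, Matrix.vecMul_sub, Pi.sub_apply, Matrix.vecMul_diagonal]
  simp only [Matrix.vecMul, dotProduct, Pi.one_apply, Matrix.of_apply, one_mul, Pi.zero_apply,
    zero_sub]
  rw [← neg_add', neg_eq_zero, ← Finset.sum_add_distrib]
  refine Finset.sum_eq_zero fun k _ => ?_
  rw [← neg_sub (x j) (x k), inv_neg, add_neg_cancel]

/-- Subtracting column `i` from the others turns the row of ones into a unit vector. The remaining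
minor is conjugate, by `diag(x_k - x_i)`, to the Scott matrix without the point `x_i`: on its
diagonal the subtraction cancels exactly the term `(x_k - x_i)⁻¹`. -/
theorem det_scottMatrix_updateRow_one (x q : ι → K) (hx : Function.Injective x) (i : ι) :
    ((scottMatrix x q).updateRow i 1).det =
      (scottMatrix (fun j : {j // j ≠ i} => x j) (fun j => q j)).det := by
  set M := (scottMatrix x q).updateRow i 1 with hM
  let N : Matrix ι ι K := Matrix.of fun k l => M k l - (if l = i then 0 else 1) * M k i
  have hMN : M.det = N.det := by
    rw [← Matrix.det_transpose M, ← Matrix.det_transpose N]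
    refine Matrix.det_eq_of_forall_row_eq_smul_add_const (fun l => if l = i then 0 else 1) i
      (by simp) fun k l => ?_
    simp [N]
  have hNi : ∀ k, ¬ k ≠ i → ∀ l, l ≠ i → N k l = 0 := by
    intro k hk l hl
    rw [not_not] at hk
    subst hk
    simp [N, M, hl]
  rw [hMN, Matrix.twoBlockTriangular_det N (fun k => k ≠ i) hNi]
  have h1 : (N.toSquareBlockProp fun k => ¬ k ≠ i).det = 1 := by
    have : (N.toSquareBlockProp fun k => ¬ k ≠ i) = 1 := by
      ext ⟨k, hk⟩ ⟨l, hl⟩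
      rw [not_not] at hk hl
      subst hk
      subst hl
      simp [N, M, Matrix.toSquareBlockProp]
    rw [this, Matrix.det_one]
  rw [h1, mul_one]
  let D : {j // j ≠ i} → K := fun k => x k - x i
  have hD : ∀ k, D k ≠ 0 := fun k => sub_ne_zero.2 (hx.ne k.2)
  have hprod : (∏ k, D k) ≠ 0 := Finset.prod_ne_zero_iff.2 fun k _ => hD k
  have key : Matrix.diagonal D * (N.toSquareBlockProp fun k => k ≠ i) =
      scottMatrix (fun j : {j // j ≠ i} => x j) (fun j => q j) * Matrix.diagonal D := by
    ext k l
    rw [Matrix.diagonal_mul, Matrix.mul_diagonal]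
    have hNkl : (N.toSquareBlockProp fun k => k ≠ i) k l =
        scottMatrix x q k l - scottMatrix x q k i := by
      simp [N, M, Matrix.toSquareBlockProp, k.2, l.2]
    rw [hNkl, scottMatrix_apply_ne x q k.2]
    by_cases hkl : k = l
    · subst hkl
      rw [scottMatrix_apply_self, scottMatrix_apply_self, mul_comm]
      congr 1
      rw [← Finset.add_sum_erase _ _ (Finset.mem_univ i),
        Finset.sum_subtype (p := fun j => j ≠ i) (Finset.univ.erase i) (by simp)
          (fun j => (x k - x j)⁻¹)]
      ring
    · have hkl' : (k : ι) ≠ l := fun h => hkl (Subtype.ext h)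
      rw [scottMatrix_apply_ne x q hkl', scottMatrix_apply_ne _ _ hkl]
      have h1 : x k - x l ≠ 0 := sub_ne_zero.2 (hx.ne hkl')
      have h2 : x k - x i ≠ 0 := sub_ne_zero.2 (hx.ne k.2)
      simp only [D]
      field_simp
      ring
  have := congrArg Matrix.det key
  rw [Matrix.det_mul, Matrix.det_mul, Matrix.det_diagonal, mul_comm] at this
  exact mul_right_cancel₀ hprod this

/-- Conjugation by `diag(x_i - y)` turns the change of `q` into the rank-one update with `u_i = 1 /
(x_i - y)` and `v = 1`, because `(x_k - y) - (x_l - y) = x_k - x_l`. -/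
theorem det_scottMatrix_add_inv (x q : ι → K) (hx : Function.Injective x) (y : K)
    (hy : ∀ i, x i ≠ y) :
    (scottMatrix x fun i => 1 / (x i - y) + q i).det = (scottMatrix x q).det +
      ∑ i, 1 / (x i - y) *
        (scottMatrix (fun j : {j // j ≠ i} => x j) (fun j => q j)).det := by
  have hD : ∀ k, x k - y ≠ 0 := fun k => sub_ne_zero.2 (hy k)
  have hprod : (∏ k, (x k - y)) ≠ 0 := Finset.prod_ne_zero_iff.2 fun k _ => hD k
  have key : (scottMatrix x fun i => 1 / (x i - y) + q i) * Matrix.diagonal (fun i => x i - y) =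
      Matrix.diagonal (fun i => x i - y) *
        (scottMatrix x q + Matrix.vecMulVec (fun i => 1 / (x i - y)) 1) := by
    ext k l
    rw [Matrix.diagonal_mul, Matrix.mul_diagonal, Matrix.add_apply, Matrix.vecMulVec_apply]
    have h1 := hD k
    by_cases hkl : k = l
    · subst hkl
      rw [scottMatrix_apply_self, scottMatrix_apply_self, Pi.one_apply]
      ring
    · rw [scottMatrix_apply_ne x _ hkl, scottMatrix_apply_ne _ _ hkl, Pi.one_apply]
      have h2 : x k - x l ≠ 0 := sub_ne_zero.2 (hx.ne hkl)
      field_simp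
      ring
  have h := congrArg Matrix.det key
  rw [Matrix.det_mul, Matrix.det_mul, Matrix.det_diagonal, mul_comm] at h
  rw [mul_left_cancel₀ hprod h, Matrix.det_add_vecMulVec_eq_sum_updateRow]
  simp_rw [det_scottMatrix_updateRow_one x q hx]

end ScottMatrix

/-! ### The permanent as a determinant -/

theorem rectPermanent_inv_sub_eq_det {ι κ K : Type*} [Fintype ι] [DecidableEq ι] [Fintype κ]
    [Field K] (x : ι → K) (hx : Function.Injective x) (y : κ → K) (hxy : ∀ i j, x i ≠ y j) :
    rectPermanent (Matrix.of fun i j => 1 / (x i - y j)) =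
      (scottMatrix x fun i => ∑ j, 1 / (x i - y j)).det := by
  -- The induction is on the columns. The row type must vary, since the recursion deletes rows.
  revert ι
  refine Fintype.induction_empty_option (P := fun κ _ => ∀ (y : κ → K) {ι : Type _}
    [Fintype ι] [DecidableEq ι] (x : ι → K), Function.Injective x → (∀ i j, x i ≠ y j) →
    rectPermanent (Matrix.of fun i j => 1 / (x i - y j)) =
      (scottMatrix x fun i => ∑ j, 1 / (x i - y j)).det) ?_ ?_ ?_ κ y
  · intro α β _ e ih y ι _ _ x hx hxy
    let _ := Fintype.ofEquiv β e.symm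
    have h := ih (y ∘ e) x hx (fun i j => hxy i (e j))
    rw [← rectPermanent_reindex (Equiv.refl ι) e] at h
    convert h using 2
    · ext i j
      simp
    · congr 1
      ext i
      exact (Fintype.sum_equiv e _ _ fun j => rfl).symm
  · intro y ι _ _ x hx _
    rcases isEmpty_or_nonempty ι with hι | hι
    · rw [Matrix.det_isEmpty, rectPermanent, Fintype.sum_eq_single (Function.Embedding.ofIsEmpty)]
      · simp
      · intro f hf
        exact absurd (Subsingleton.elim _ _) hf
    · have h0 : (fun i => ∑ j : PEmpty, 1 / (x i - y j)) = 0 := by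
        ext i
        simp
      rw [h0, det_scottMatrix_zero]
      exact Fintype.sum_eq_zero _ fun f => (f (Classical.arbitrary ι)).elim
  · intro κ _ ih y ι _ _ x hx hxy
    rw [rectPermanent_option]
    simp_rw [Fintype.sum_option]
    rw [det_scottMatrix_add_inv x _ hx _ (fun i => hxy i none)]
    congr 1
    · exact ih (fun j => y (some j)) x hx (fun i j => hxy i _)
    · refine Finset.sum_congr rfl fun i _ => ?_
      congr 1
      exact ih (fun j => y (some j)) (fun j : {j // j ≠ i} => x j)
        (hx.comp Subtype.val_injective) (fun i j => hxy i _)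

/-! ### Determinant of a cyclic bidiagonal matrix -/

section CyclicDet

variable {R : Type*} [CommRing R]

/-- The matrix with entries `α_j` on the diagonal and `β_j` just below it, cyclically. -/
def cyclicBidiagonal {e : ℕ} [NeZero e] (α β : Fin e → R) : Matrix (Fin e) (Fin e) R :=
  Matrix.of fun i j => (if i = j then α j else 0) + if i = j + 1 then β j else 0

theorem det_cyclicBidiagonal {e : ℕ} [NeZero e] (α β : Fin e → R) :
    (cyclicBidiagonal α β).det = ∏ j, α j - (-1) ^ e * ∏ j, β j := by
  obtain ⟨e, rfl⟩ := Nat.exists_eq_succ_of_ne_zero (NeZero.ne e)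
  rw [Matrix.det_succ_row_zero]
  -- Only the entries `α_0` and `β_last` occur in row `0`, and both minors are triangular. In size
  -- one the two entries coincide and add up, hence the sum of two indicators.
  have hrow : ∀ j : Fin (e + 1), cyclicBidiagonal α β 0 j =
      (if j = 0 then α 0 else 0) + if j = Fin.last e then β (Fin.last e) else 0 := by
    intro j
    have h0 : (0 = j + 1) ↔ j = Fin.last e := by
      rw [eq_comm, ← Fin.last_add_one e, add_left_inj]
    simp only [cyclicBidiagonal, Matrix.of_apply]
    congr 1
    · by_cases hj : j = 0
      · simp [hj]
      · simp [hj, Ne.symm hj]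
    · by_cases hj : j = Fin.last e
      · simp [hj]
      · have := h0.not.2 hj
        simp [hj, this]
  have hfirst : ((cyclicBidiagonal α β).submatrix Fin.succ (Fin.succAbove 0)).det =
      ∏ j : Fin e, α j.succ := by
    rw [Matrix.det_of_isLowerTriangular]
    · refine Finset.prod_congr rfl fun j _ => ?_
      have : j.succ ≠ j.succ + 1 := by
        intro h
        have h2 : (1 : Fin (e + 1)) = 0 := by simpa using h
        have h3 : e ≠ 0 := fun he => by subst he; exact j.elim0
        exact h3 (by simpa using (Fin.one_eq_zero_iff.1 h2))
      simp only [cyclicBidiagonal, Matrix.submatrix_apply, Fin.succAbove_zero, Matrix.of_apply]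
      rw [if_neg this, if_true, add_zero]
    · intro i j hij
      have hij : i < j := hij
      have h1 : i.succ ≠ j.succ := fun h => hij.ne (Fin.succ_injective _ h)
      have h2 : i.succ ≠ j.succ + 1 := by
        intro h
        have := congrArg Fin.val h
        rw [Fin.val_add_one] at this
        have hij' : (i : ℕ) < j := hij
        split_ifs at this
        · simp at this
        · simp at this
          omega
      simp [cyclicBidiagonal, h1, h2]
  have hlast : ((cyclicBidiagonal α β).submatrix Fin.succ (Fin.succAbove (Fin.last e))).det =
      ∏ j : Fin e, β j.castSucc := by
    rw [Matrix.det_of_isUpperTriangular]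
    · refine Finset.prod_congr rfl fun j _ => ?_
      have : j.succ ≠ j.castSucc := (Fin.castSucc_lt_succ).ne'
      simp only [cyclicBidiagonal, Matrix.submatrix_apply, Fin.succAbove_last, Matrix.of_apply]
      rw [if_neg this, if_pos (Fin.coeSucc_eq_succ).symm, zero_add]
    · intro i j hij
      have hij : j < i := hij
      have h1 : i.succ ≠ j.castSucc := (Fin.castSucc_lt_succ.trans
        (Fin.succ_lt_succ_iff.2 hij)).ne'
      have h2 : i.succ ≠ j.succ := fun h => hij.ne' (Fin.succ_injective _ h)
      simp [cyclicBidiagonal, h1, h2]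
  simp_rw [hrow, mul_add, add_mul, Finset.sum_add_distrib, mul_ite, ite_mul, mul_zero, zero_mul]
  rw [Finset.sum_ite_eq' Finset.univ (0 : Fin (e + 1)) (fun j => (-1) ^ (j : ℕ) * α 0 *
      ((cyclicBidiagonal α β).submatrix Fin.succ j.succAbove).det),
    Finset.sum_ite_eq' Finset.univ (Fin.last e) (fun j => (-1) ^ (j : ℕ) * β (Fin.last e) *
      ((cyclicBidiagonal α β).submatrix Fin.succ j.succAbove).det)]
  rw [if_pos (Finset.mem_univ _), if_pos (Finset.mem_univ _), hfirst, hlast,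
    Fin.prod_univ_succ, Fin.prod_univ_castSucc β]
  simp only [Fin.val_zero, Fin.val_last, pow_succ, pow_zero]
  ring

end CyclicDet

/-! ### Exponents modulo `n` arranged in cycles under adding `r` -/

section CosetExponent

/-- The exponent `i + d ((j r) mod e)`: for `r` coprime to `e` these run over `0, …, d e - 1`, and
increasing `j` by one adds `d r` modulo `d e`. -/
def cosetExponent (d e r : ℕ) (j : Fin e) (i : Fin d) : ℕ := i + d * ((j * r) % e)

theorem cosetExponent_lt {d e r : ℕ} (j : Fin e) (i : Fin d) :
    cosetExponent d e r j i < d * e := by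
  have h1 : ((j : ℕ) * r) % e + 1 ≤ e := Nat.mod_lt _ j.pos
  calc cosetExponent d e r j i < d + d * ((j * r) % e) := by
        unfold cosetExponent
        have := i.2
        omega
    _ = d * (((j : ℕ) * r) % e + 1) := by ring
    _ ≤ d * e := Nat.mul_le_mul_left _ h1

theorem mul_mod_injective {e r : ℕ} (h : Nat.Coprime e r) :
    Function.Injective fun j : Fin e => (⟨((j : ℕ) * r) % e, Nat.mod_lt _ j.pos⟩ : Fin e) := by
  intro j k hjk
  have h1 : (j : ℕ) * r ≡ k * r [MOD e] := congrArg Fin.val hjk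
  have h2 : (j : ℕ) ≡ k [MOD e] := Nat.ModEq.cancel_right_of_coprime h h1
  exact Fin.ext (Nat.ModEq.eq_of_lt_of_lt h2 j.2 k.2)

theorem cosetExponent_injective {d e r : ℕ} (h : Nat.Coprime e r) :
    Function.Injective fun p : Fin e × Fin d => cosetExponent d e r p.1 p.2 := by
  rintro ⟨j, i⟩ ⟨k, l⟩ hp
  have hd : 0 < d := i.pos
  have hp : (i : ℕ) + d * ((j * r) % e) = l + d * ((k * r) % e) := hp
  have h1 := congrArg (· % d) hp
  have h2 := congrArg (· / d) hp
  simp only [Nat.add_mul_mod_self_left, Nat.mod_eq_of_lt i.2, Nat.mod_eq_of_lt l.2] at h1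
  simp only [Nat.add_mul_div_left _ _ hd, Nat.div_eq_of_lt i.2, Nat.div_eq_of_lt l.2,
    zero_add] at h2
  exact Prod.ext (mul_mod_injective h (Fin.ext h2)) (Fin.ext h1)

theorem pow_cosetExponent {M : Type*} [CommMonoid M] {d e r : ℕ} {x : M} (hx : x ^ (d * e) = 1)
    (j : Fin e) (i : Fin d) :
    x ^ cosetExponent d e r j i = x ^ (i : ℕ) * (x ^ (d * r)) ^ (j : ℕ) := by
  rw [cosetExponent, pow_add, ← Nat.mul_mod_mul_left, ← pow_eq_pow_mod _ hx, ← pow_mul]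
  congr 2
  ring

/-- The statement concerns powers because the exponents themselves agree only modulo `d * e`. -/
theorem pow_cosetExponent_add_one {M : Type*} [CommMonoid M] {d e r : ℕ} [NeZero e] {x : M}
    (hx : x ^ (d * e) = 1) (j : Fin e) (i : Fin d) :
    x ^ cosetExponent d e r (j + 1) i = x ^ (cosetExponent d e r j i + d * r) := by
  have h1 : (x ^ (d * r)) ^ e = 1 := by
    rw [← pow_mul, mul_right_comm, pow_mul, hx, one_pow]
  rw [pow_add, pow_cosetExponent hx, pow_cosetExponent hx, Fin.val_add, ← pow_eq_pow_mod _ h1,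
    Fin.val_one', pow_add, ← pow_eq_pow_mod _ h1, pow_one, mul_assoc]

theorem prod_cosetExponent {M : Type*} [CommMonoid M] {d e r : ℕ} (h : Nat.Coprime e r)
    (f : ℕ → M) (i : Fin d) :
    ∏ j, f (cosetExponent d e r j i) = ∏ j ∈ Finset.range e, f (i + d * j) := by
  rw [← Fin.prod_univ_eq_prod_range (fun j => f (i + d * j)),
    ← (Finite.injective_iff_bijective.1 (mul_mod_injective h)).prod_comp
      (fun j : Fin e => f (i + d * j))]
  rfl

end CosetExponent

/-! ### Action of the Scott matrix on powers of roots of unity -/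

section RootsOfUnity

variable {K : Type*} [Field K] {n : ℕ}

/-- The `n`-th roots of unity as elements of the field. -/
def rootOfUnityVal (K : Type*) [Field K] (n : ℕ) : rootsOfUnity n K →* K :=
  (Units.coeHom K).comp (rootsOfUnity n K).subtype

theorem rootOfUnityVal_injective : Function.Injective (rootOfUnityVal K n) :=
  Units.val_injective.comp Subtype.val_injective

theorem rootOfUnityVal_ne_zero (g : rootsOfUnity n K) : rootOfUnityVal K n g ≠ 0 :=
  Units.ne_zero (g : Kˣ)

theorem pow_rootsOfUnity_eq_one (g : rootsOfUnity n K) : g ^ n = 1 :=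
  Subtype.ext ((mem_rootsOfUnity _ _).1 g.2)

theorem rootOfUnityVal_pow_eq_one (g : rootsOfUnity n K) : rootOfUnityVal K n g ^ n = 1 := by
  rw [← map_pow, pow_rootsOfUnity_eq_one, map_one]

variable [NeZero n]

theorem exists_rootOfUnityVal_eq {z : K} (hz : z ^ n = 1) : ∃ g, rootOfUnityVal K n g = z :=
  ⟨rootsOfUnity.mkOfPowEq z hz, rfl⟩

variable [IsAlgClosed K] [CharZero K] [Fintype (rootsOfUnity n K)]

theorem card_rootsOfUnity_of_isAlgClosed : Fintype.card (rootsOfUnity n K) = n := by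
  rw [← Nat.card_eq_fintype_card]
  exact HasEnoughRootsOfUnity.natCard_rootsOfUnity K n

theorem sum_zpow_rootOfUnityVal {s : ℤ} (hs : ¬ (n : ℤ) ∣ s) :
    ∑ g : rootsOfUnity n K, rootOfUnityVal K n g ^ s = 0 := by
  let f : rootsOfUnity n K →* K := (rootOfUnityVal K n).comp (zpowGroupHom s)
  have hf : f ≠ 1 := by
    obtain ⟨ζ, hζ⟩ := HasEnoughRootsOfUnity.exists_primitiveRoot K n
    obtain ⟨g, hg⟩ := exists_rootOfUnityVal_eq hζ.pow_eq_one
    intro h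
    have h1 : rootOfUnityVal K n (g ^ s) = 1 := DFunLike.congr_fun h g
    rw [map_zpow', hg] at h1
    · exact hs ((hζ.zpow_eq_one_iff_dvd s).1 h1)
    · intro x
      exact Units.val_inv_eq_inv_val _
  rw [← sum_hom_units_eq_zero f hf]
  refine Finset.sum_congr rfl fun g _ => ?_
  exact (map_zpow' _ (fun x => Units.val_inv_eq_inv_val _) g s).symm

/-- Pair `h` with `g ^ 2 / h`: with `w = x_h / x_g`, one has `1 / (1 - w) + 1 / (1 - w⁻¹) = 1` for
`w ≠ 1`. The term `h = g` is `0` since `0⁻¹ = 0`. -/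
theorem sum_inv_sub_rootOfUnityVal [DecidableEq (rootsOfUnity n K)] (g : rootsOfUnity n K) :
    2 * ∑ h, (rootOfUnityVal K n g - rootOfUnityVal K n h)⁻¹ * rootOfUnityVal K n g = n - 1 := by
  set x := rootOfUnityVal K n with hx
  have hinv : ∑ h, (x g - x h)⁻¹ * x g = ∑ h, (x g - x (g ^ 2 / h))⁻¹ * x g :=
    (Fintype.sum_equiv (Equiv.divLeft (g ^ 2)) _ _ fun h => rfl).symm
  rw [two_mul]
  nth_rewrite 2 [hinv]
  rw [← Finset.sum_add_distrib]
  have hterm : ∀ h, (x g - x h)⁻¹ * x g + (x g - x (g ^ 2 / h))⁻¹ * x g =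
      1 - if h = g then 1 else 0 := by
    intro h
    have h0 := rootOfUnityVal_ne_zero g
    have h1 := rootOfUnityVal_ne_zero h
    rw [← hx] at h0 h1
    have h2 : x (g ^ 2 / h) = x g ^ 2 / x h := by
      rw [eq_div_iff h1, ← map_mul, ← map_pow, div_mul_cancel]
    rw [h2]
    by_cases hgh : h = g
    · subst hgh
      rw [if_pos rfl, pow_two, mul_div_cancel_right₀ _ h0]
      simp
    · have h3 : x g - x h ≠ 0 := sub_ne_zero.2 (rootOfUnityVal_injective.ne (Ne.symm hgh))
      have h4 : x g - x g ^ 2 / x h ≠ 0 := by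
        have : x g - x g ^ 2 / x h = -(x g * (x g - x h) / x h) := by
          field_simp
          ring
        rw [this]
        exact neg_ne_zero.2 (div_ne_zero (mul_ne_zero h0 h3) h1)
      have h5 : x h - x g ≠ 0 := by
        rw [← neg_sub]
        exact neg_ne_zero.2 h3
      rw [if_neg hgh]
      have h6 : x g - x g ^ 2 / x h = x g * (x h - x g) / x h := by
        field_simp
      rw [h6]
      field_simp
      ring
  rw [Finset.sum_congr rfl fun h _ => hterm h]
  simp [card_rootsOfUnity_of_isAlgClosed]

/-- The quotient `(x_g^(k+1) - x_h^(k+1)) / (x_g - x_h)` is a geometric sum. Summed over all `h`,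
only its term `x_h^0` survives, as `k < n`; the value `(k+1) x_g^k` at `h = g` has to be taken out.
-/
theorem sum_inv_sub_mul_pow_rootOfUnityVal [DecidableEq (rootsOfUnity n K)]
    (g : rootsOfUnity n K) {k : ℕ} (hk : k < n) :
    ∑ h, (rootOfUnityVal K n g - rootOfUnityVal K n h)⁻¹ * rootOfUnityVal K n h ^ (k + 1) =
      (∑ h, (rootOfUnityVal K n g - rootOfUnityVal K n h)⁻¹) * rootOfUnityVal K n g ^ (k + 1) -
        (n - k - 1) * rootOfUnityVal K n g ^ k := by
  set x := rootOfUnityVal K n with hx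
  have hterm : ∀ h, (x g - x h)⁻¹ * x h ^ (k + 1) = (x g - x h)⁻¹ * x g ^ (k + 1) -
      (∑ s ∈ Finset.range (k + 1), x h ^ s * x g ^ (k - s) -
        if h = g then (k + 1) * x g ^ k else 0) := by
    intro h
    by_cases hgh : h = g
    · subst hgh
      rw [if_pos rfl]
      have : ∑ s ∈ Finset.range (k + 1), x h ^ s * x h ^ (k - s) = (k + 1) * x h ^ k := by
        rw [Finset.sum_congr rfl fun s hs => ?_, Finset.sum_const, Finset.card_range,
          nsmul_eq_mul, Nat.cast_add_one]
        rw [← pow_add]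
        congr 1
        have := Finset.mem_range.1 hs
        omega
      rw [this]
      ring
    · have h3 : x g - x h ≠ 0 := sub_ne_zero.2 (rootOfUnityVal_injective.ne (Ne.symm hgh))
      have := (Commute.all (x h) (x g)).geom_sum₂_mul (k + 1)
      simp only [Nat.add_sub_cancel] at this
      rw [if_neg hgh]
      field_simp
      linear_combination -this
  rw [Finset.sum_congr rfl fun h _ => hterm h, Finset.sum_sub_distrib, Finset.sum_sub_distrib,
    Finset.sum_comm, Finset.sum_mul]
  have hsum : ∑ s ∈ Finset.range (k + 1), ∑ h, x h ^ s * x g ^ (k - s) = n * x g ^ k := by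
    rw [Finset.sum_eq_single_of_mem 0 (by simp)]
    · simp [card_rootsOfUnity_of_isAlgClosed]
    · intro s hs hs0
      rw [← Finset.sum_mul]
      have h1 : ¬ (n : ℤ) ∣ (s : ℤ) := by
        rw [Int.natCast_dvd_natCast]
        intro hdvd
        have := Nat.le_of_dvd (Nat.pos_of_ne_zero hs0) hdvd
        have := Finset.mem_range.1 hs
        omega
      have := sum_zpow_rootOfUnityVal (K := K) h1
      simp only [zpow_natCast] at this
      rw [this, zero_mul]
  rw [hsum]
  simp only [Finset.sum_ite_eq', Finset.mem_univ, if_true]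
  ring

/-- The sum of the inverses arises twice, from the diagonal and from the other entries, so
`sum_inv_sub_rootOfUnityVal` gives `n - 1` in total, and `n` cancels. -/
theorem scottMatrix_rootOfUnityVal_sum [DecidableEq (rootsOfUnity n K)]
    (q : rootsOfUnity n K → K) (g : rootsOfUnity n K) {k : ℕ} (hk : k < n) :
    ∑ h, scottMatrix (rootOfUnityVal K n) q g h * rootOfUnityVal K n h ^ (k + 1) =
      q g * rootOfUnityVal K n g ^ (k + 1) - k * rootOfUnityVal K n g ^ k := by
  have h1 := sum_inv_sub_mul_pow_rootOfUnityVal g hk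
  have h2 := sum_inv_sub_rootOfUnityVal g
  rw [← Finset.sum_mul] at h2
  have h3 : ∑ h, scottMatrix (rootOfUnityVal K n) q g h * rootOfUnityVal K n h ^ (k + 1) =
      (q g - ∑ h, (rootOfUnityVal K n g - rootOfUnityVal K n h)⁻¹) *
        rootOfUnityVal K n g ^ (k + 1) -
      ∑ h, (rootOfUnityVal K n g - rootOfUnityVal K n h)⁻¹ * rootOfUnityVal K n h ^ (k + 1) := by
    simp only [scottMatrix, Matrix.sub_apply, Matrix.diagonal_apply, Matrix.of_apply, sub_mul,
      Finset.sum_sub_distrib, ite_mul, zero_mul, Finset.sum_ite_eq, Finset.mem_univ, if_true]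
  rw [h3, h1]
  linear_combination (-rootOfUnityVal K n g ^ k) * h2

/-- A matrix acting on the vectors `(x_g ^ k)_g` as `x^k ↦ c (α_k x^k + β_k x^(k + r))` is similar
to a product of a diagonal matrix and a block diagonal matrix with cyclic bidiagonal blocks. -/
theorem det_eq_of_monomial_action [DecidableEq (rootsOfUnity n K)] (r : ℕ)
    (T : Matrix (rootsOfUnity n K) (rootsOfUnity n K) K) (c : rootsOfUnity n K → K) (α β : ℕ → K)
    (hT : ∀ g, ∀ k < n, ∑ h, T g h * rootOfUnityVal K n h ^ k =
      c g * (α k * rootOfUnityVal K n g ^ k + β k * rootOfUnityVal K n g ^ (k + r))) :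
    T.det = (∏ g, c g) * ∏ i ∈ Finset.range (n.gcd r),
      (∏ j ∈ Finset.range (n / n.gcd r), α (i + n.gcd r * j) -
        (-1) ^ (n / n.gcd r) * ∏ j ∈ Finset.range (n / n.gcd r), β (i + n.gcd r * j)) := by
  set d := n.gcd r with hd
  set e := n / d with he
  have hn : 0 < n := Nat.pos_of_ne_zero (NeZero.ne n)
  have hd0 : 0 < d := Nat.gcd_pos_of_pos_left _ hn
  have hde : d * e = n := Nat.mul_div_cancel' (Nat.gcd_dvd_left n r)
  have hdr : d * (r / d) = r := Nat.mul_div_cancel' (Nat.gcd_dvd_right n r)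
  have hcop : Nat.Coprime e (r / d) := Nat.coprime_div_gcd_div_gcd hd0
  have he0 : e ≠ 0 := fun h => by
    rw [h, mul_zero] at hde
    omega
  have : NeZero e := ⟨he0⟩
  let x := rootOfUnityVal K n
  have hx0 : ∀ g, x g ≠ 0 := rootOfUnityVal_ne_zero
  have hx1 : ∀ g, x g ^ (d * e) = 1 := fun g => by
    rw [hde]
    exact rootOfUnityVal_pow_eq_one g
  -- With exponents indexed by pairs `(j, i)`, multiplication by `x^r` fixes `i` and moves `j` to `j
  -- + 1` cyclically.
  let ε : Fin e × Fin d → ℕ := fun p => cosetExponent d e (r / d) p.1 p.2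
  have hε : ∀ p, ε p < n := fun p => hde ▸ cosetExponent_lt p.1 p.2
  let V : Matrix (rootsOfUnity n K) (Fin e × Fin d) K := Matrix.of fun g p => x g ^ ε p
  let U : Matrix (Fin e × Fin d) (rootsOfUnity n K) K :=
    Matrix.of fun p g => (n : K)⁻¹ * (x g ^ ε p)⁻¹
  -- Orthogonality of characters: distinct exponents in `[0, n)` are incongruent modulo `n`.
  have hUV : U * V = 1 := by
    ext p q
    have hsum : (U * V) p q = (n : K)⁻¹ * ∑ g, x g ^ ((ε q : ℤ) - ε p) := by
      rw [Matrix.mul_apply, Finset.mul_sum]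
      refine Finset.sum_congr rfl fun g _ => ?_
      rw [zpow_sub₀ (hx0 g), zpow_natCast, zpow_natCast]
      simp only [U, V, Matrix.of_apply]
      ring
    rw [hsum]
    by_cases hpq : p = q
    · subst hpq
      rw [sub_self]
      simp only [zpow_zero, Finset.sum_const, Finset.card_univ, card_rootsOfUnity_of_isAlgClosed,
        nsmul_eq_mul, mul_one, Matrix.one_apply_eq]
      exact inv_mul_cancel₀ (Nat.cast_ne_zero.2 hn.ne')
    · rw [sum_zpow_rootOfUnityVal, mul_zero, Matrix.one_apply_ne hpq]
      intro hdvd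
      have h1 : ε q ≠ ε p := fun h => hpq (cosetExponent_injective hcop h).symm
      have h2 := hε p
      have h3 := hε q
      have h4 := Int.eq_zero_of_abs_lt_dvd hdvd (by rw [abs_lt]; omega)
      omega
  have hcard : Fintype.card (rootsOfUnity n K) = Fintype.card (Fin e × Fin d) := by
    rw [card_rootsOfUnity_of_isAlgClosed, Fintype.card_prod, Fintype.card_fin, Fintype.card_fin,
      mul_comm, hde]
  have hVU : V * U = 1 := (Matrix.mul_eq_one_comm_of_card_eq _ _ _ hcard).2 hUV
  let C : Matrix (Fin e × Fin d) (Fin e × Fin d) K := Matrix.blockDiagonal fun i =>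
    cyclicBidiagonal (fun j => α (ε (j, i))) (fun j => β (ε (j, i)))
  have hTV : T * V = Matrix.diagonal c * (V * C) := by
    ext g ⟨j, i⟩
    rw [Matrix.diagonal_mul, Matrix.mul_apply]
    refine (hT g (ε (j, i)) (hε _)).trans ?_
    congr 1
    rw [Matrix.mul_apply, ← Finset.univ_product_univ, Finset.sum_product]
    simp only [V, C, Matrix.of_apply, Matrix.blockDiagonal_apply, mul_ite, mul_zero,
      Finset.sum_ite_eq', Finset.mem_univ, if_true]
    simp only [cyclicBidiagonal, Matrix.of_apply, mul_add, Finset.sum_add_distrib, mul_ite,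
      mul_zero, Finset.sum_ite_eq', Finset.mem_univ, if_true]
    have h1 : x g ^ ε (j + 1, i) = x g ^ (ε (j, i) + r) := by
      refine (pow_cosetExponent_add_one (hx1 g) j i).trans ?_
      rw [hdr]
    rw [h1]
    change α _ * x g ^ _ + β _ * x g ^ _ = _
    ring
  have hTdet : T = Matrix.diagonal c * (V * C * U) := by
    rw [← Matrix.mul_assoc, ← hTV, Matrix.mul_assoc, hVU, Matrix.mul_one]
  rw [hTdet, Matrix.det_mul, Matrix.det_diagonal, Matrix.det_conj_of_mul_eq_one hVU hUV,
    Matrix.det_blockDiagonal]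
  congr 1
  rw [← Fin.prod_univ_eq_prod_range (fun i => ∏ j ∈ Finset.range e, α (i + d * j) -
    (-1) ^ e * ∏ j ∈ Finset.range e, β (i + d * j))]
  refine Finset.prod_congr rfl fun i _ => ?_
  rw [det_cyclicBidiagonal, ← prod_cosetExponent hcop α i, ← prod_cosetExponent hcop β i]

/-- The product is the determinant of a diagonal matrix, which acts on monomials with constant `α =
A`, `β = B`. -/
theorem prod_add_mul_pow_rootOfUnityVal (r : ℕ) (A B : K) :
    ∏ g, (A + B * rootOfUnityVal K n g ^ r) =
      (A ^ (n / n.gcd r) - (-B) ^ (n / n.gcd r)) ^ n.gcd r := by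
  classical
  rw [← Matrix.det_diagonal, det_eq_of_monomial_action r _ 1 (fun _ => A) (fun _ => B)]
  · simp [neg_pow B]
  · intro g k _
    simp only [Matrix.diagonal_apply, ite_mul, zero_mul, Finset.sum_ite_eq, Finset.mem_univ,
      if_true, Pi.one_apply]
    ring

theorem prod_rootOfUnityVal : ∏ g, rootOfUnityVal K n g = -(-1) ^ n := by
  have := prod_add_mul_pow_rootOfUnityVal (K := K) (n := n) 1 0 1
  simpa [NeZero.ne n] using this

end RootsOfUnity

/-! ### `Q` and `z Q'` at roots of unity -/

section TwoClassPoly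

variable {K : Type*} [Field K] {n m r : ℕ} {a b : ℕ → K}

theorem eval_twoClassPoly {z : K} (hz : z ^ n = 1) :
    (twoClassPoly n m r a b).eval z =
      ∑ l ∈ Finset.range (m + 1), a l + (∑ l ∈ Finset.range (m + 1), b l) * z ^ r := by
  have h : ∀ l, z ^ (l * n) = 1 := fun l => by rw [mul_comm, pow_mul, hz, one_pow]
  simp [twoClassPoly, eval_finsetSum, pow_add, h, Finset.sum_mul]

theorem mul_eval_derivative_twoClassPoly {z : K} (hz : z ^ n = 1) :
    z * (twoClassPoly n m r a b).derivative.eval z =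
      ∑ l ∈ Finset.range (m + 1), (l * n : K) * a l +
        (∑ l ∈ Finset.range (m + 1), (l * n + r : K) * b l) * z ^ r := by
  have h : ∀ l, z ^ (l * n) = 1 := fun l => by rw [mul_comm, pow_mul, hz, one_pow]
  -- For `k = 0` the truncated exponent `k - 1` is harmless, its coefficient being zero.
  have hpow : ∀ k : ℕ, z * ((k : K) * z ^ (k - 1)) = k * z ^ k := by
    rintro (_ | k)
    · simp
    · rw [Nat.add_sub_cancel, pow_succ]
      ring
  simp only [twoClassPoly, derivative_add, derivative_sum, derivative_C_mul_X_pow, eval_add,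
    eval_finsetSum, eval_mul, eval_C, eval_pow, eval_X, mul_add, Finset.mul_sum, Finset.sum_mul]
  congr 1 <;> refine Finset.sum_congr rfl fun l _ => ?_
  · rw [mul_assoc (a l), mul_left_comm, hpow, h]
    push_cast
    ring
  · rw [mul_assoc (b l), mul_left_comm, hpow, pow_add, h]
    push_cast
    ring

end TwoClassPoly

/-! ### Evaluation of the permanent for `x^n - 1` -/

section ScottPermanent

variable {K : Type*} [Field K] {n : ℕ} [NeZero n]

theorem nodup_roots_X_pow_sub_one [CharZero K] : (X ^ n - 1 : K[X]).roots.Nodup := by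
  apply nodup_roots
  have := separable_X_pow_sub_C (1 : K) (n := n) (Nat.cast_ne_zero.2 (NeZero.ne n)) one_ne_zero
  rwa [map_one] at this

theorem mem_roots_X_pow_sub_one {z : K} : z ∈ (X ^ n - 1 : K[X]).roots ↔ z ^ n = 1 := by
  have hne : (X ^ n - 1 : K[X]) ≠ 0 := by
    rw [← map_one C]
    exact X_pow_sub_C_ne_zero (Nat.pos_of_ne_zero (NeZero.ne n)) _
  simp [mem_roots hne, IsRoot.def, sub_eq_zero]

variable [IsAlgClosed K] [CharZero K]

/-- The zeros of `x^n - 1` are simple, so rows correspond to roots of unity; `q` is the logarithmic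
derivative of `Q`, which splits. -/
theorem scottPermanent_X_pow_sub_one_eq_det [Fintype (rootsOfUnity n K)]
    [DecidableEq (rootsOfUnity n K)] (Q : K[X])
    (hQ : ∀ z : K, z ^ n = 1 → Q.eval z ≠ 0) :
    scottPermanent (X ^ n - 1) Q = (scottMatrix (rootOfUnityVal K n) fun g =>
      Q.derivative.eval (rootOfUnityVal K n g) / Q.eval (rootOfUnityVal K n g)).det := by
  classical
  have hroot : ∀ y : (X ^ n - 1 : K[X]).roots, y.1 ^ n = 1 := fun y =>
    mem_roots_X_pow_sub_one.1 Multiset.coe_mem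
  let f : (X ^ n - 1 : K[X]).roots → rootsOfUnity n K := fun y =>
    rootsOfUnity.mkOfPowEq y.1 (hroot y)
  have hval : ∀ y, rootOfUnityVal K n (f y) = y.1 := fun y => rfl
  have hf : Function.Bijective f := by
    constructor
    · rintro ⟨y, i⟩ ⟨z, j⟩ h
      have hyz : y = z := congrArg (rootOfUnityVal K n) h
      subst hyz
      congr 1
      have h1 := Multiset.nodup_iff_count_le_one.1 (nodup_roots_X_pow_sub_one (K := K) (n := n)) y
      have hi := i.2
      have hj := j.2
      exact Fin.ext (by omega)
    · intro g
      have hg := (mem_roots_X_pow_sub_one (n := n)).2 (rootOfUnityVal_pow_eq_one g)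
      refine ⟨⟨rootOfUnityVal K n g, 0, Multiset.count_pos.2 hg⟩, ?_⟩
      exact rootOfUnityVal_injective (hval _)
  have hQ0 : Q ≠ 0 := fun h => hQ 1 (one_pow n) (by rw [h, eval_zero])
  have hne : ∀ (g : rootsOfUnity n K) (y : Q.roots), rootOfUnityVal K n g ≠ y.1 := by
    intro g y h
    refine hQ _ (rootOfUnityVal_pow_eq_one g) ?_
    rw [h]
    exact (mem_roots hQ0).1 Multiset.coe_mem
  have hlog : ∀ g : rootsOfUnity n K, Q.derivative.eval (rootOfUnityVal K n g) /
      Q.eval (rootOfUnityVal K n g) = ∑ y : Q.roots, 1 / (rootOfUnityVal K n g - y.1) := by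
    intro g
    rw [(IsAlgClosed.splits Q).eval_derivative_div_eval_of_ne_zero
      (hQ _ (rootOfUnityVal_pow_eq_one g)), Finset.sum,
      Multiset.map_univ _ (fun z => 1 / (rootOfUnityVal K n g - z))]
  simp_rw [hlog]
  rw [← rectPermanent_inv_sub_eq_det _ rootOfUnityVal_injective _ hne, scottPermanent,
    ← rectPermanent_reindex (Equiv.ofBijective f hf) (Equiv.refl _)]
  congr 1
  ext g y
  have : rootOfUnityVal K n g = ((Equiv.ofBijective f hf).symm g).1 := by
    rw [← hval]
    congr 1
    exact ((Equiv.ofBijective f hf).apply_symm_apply g).symm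
  simp [this]

theorem scottPermanent_twoClassPoly {m r : ℕ} {a b : ℕ → K} {A B : K}
    (hA : A = ∑ l ∈ Finset.range (m + 1), a l) (hB : B = ∑ l ∈ Finset.range (m + 1), b l)
    (hQ : ∀ z : K, z ^ n = 1 → (twoClassPoly n m r a b).eval z ≠ 0) :
    (A ^ (n / n.gcd r) - (-B) ^ (n / n.gcd r)) ^ n.gcd r ≠ 0 ∧
    scottPermanent (X ^ n - 1) (twoClassPoly n m r a b) =
      -((-1) ^ n * ∏ i ∈ Finset.range (n.gcd r), (∏ j ∈ Finset.range (n / n.gcd r),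
          ∑ l ∈ Finset.range (m + 1), ((l * n : K) - (i + n.gcd r * j : ℕ)) * a l -
        (-1) ^ (n / n.gcd r) * ∏ j ∈ Finset.range (n / n.gcd r),
          ∑ l ∈ Finset.range (m + 1), ((l * n + r : K) - (i + n.gcd r * j : ℕ)) * b l)) /
      (A ^ (n / n.gcd r) - (-B) ^ (n / n.gcd r)) ^ n.gcd r := by
  classical
  let _ : Fintype (rootsOfUnity n K) := Fintype.ofFinite _
  let x := rootOfUnityVal K n
  have hx0 : ∀ g, x g ≠ 0 := rootOfUnityVal_ne_zero
  have hev : ∀ g, (twoClassPoly n m r a b).eval (x g) = A + B * x g ^ r := fun g => by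
    rw [eval_twoClassPoly (rootOfUnityVal_pow_eq_one g), hA, hB]
  have hev0 : ∀ g, A + B * x g ^ r ≠ 0 := fun g => by
    rw [← hev]
    exact hQ _ (rootOfUnityVal_pow_eq_one g)
  have hprod := prod_add_mul_pow_rootOfUnityVal (K := K) (n := n) r A B
  refine ⟨hprod ▸ Finset.prod_ne_zero_iff.2 fun g _ => hev0 g, ?_⟩
  rw [scottPermanent_X_pow_sub_one_eq_det _ hQ]
  set M := scottMatrix (rootOfUnityVal K n) fun g =>
    (twoClassPoly n m r a b).derivative.eval (rootOfUnityVal K n g) /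
      (twoClassPoly n m r a b).eval (rootOfUnityVal K n g) with hM
  -- The factor `diag(x)` shifts the exponents `1, …, n` to `0, …, n - 1`. The `α_k` and `β_k` are
  -- the coefficients of `z Q' - k Q` reduced by `z^n = 1`.
  have hdet := det_eq_of_monomial_action r (M * Matrix.diagonal x)
    (fun g => (A + B * x g ^ r)⁻¹)
    (fun k => ∑ l ∈ Finset.range (m + 1), ((l * n : K) - k) * a l)
    (fun k => ∑ l ∈ Finset.range (m + 1), ((l * n + r : K) - k) * b l) (by
      intro g k hk
      have h1 : ∀ h, (M * Matrix.diagonal x) g h * rootOfUnityVal K n h ^ k =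
          M g h * x h ^ (k + 1) := fun h => by
        rw [Matrix.mul_diagonal, pow_succ', mul_assoc]
      simp_rw [h1]
      refine (scottMatrix_rootOfUnityVal_sum _ g hk).trans ?_
      have h2 := mul_eval_derivative_twoClassPoly (m := m) (r := r) (a := a) (b := b)
        (rootOfUnityVal_pow_eq_one g)
      change x g * (twoClassPoly n m r a b).derivative.eval (x g) = _ + _ * x g ^ r at h2
      change (twoClassPoly n m r a b).derivative.eval (x g) /
        (twoClassPoly n m r a b).eval (x g) * x g ^ (k + 1) - k * x g ^ k = _
      simp_rw [sub_mul _ (k : K), Finset.sum_sub_distrib, ← Finset.mul_sum, ← hA, ← hB]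
      rw [hev, eq_inv_mul_iff_mul_eq₀ (hev0 g), mul_sub, pow_succ', ← mul_assoc,
        mul_div_cancel₀ _ (hev0 g)]
      change _ = (_ - k * A) * x g ^ k + (_ - k * B) * x g ^ (k + r)
      rw [pow_add]
      linear_combination (x g ^ k) * h2)
  rw [Matrix.det_mul, Matrix.det_diagonal, prod_rootOfUnityVal, Finset.prod_inv_distrib,
    hprod] at hdet
  -- The determinant `-(-1)^n` of `diag(x)` is its own inverse.
  have hsign : ((-1 : K) ^ n) * (-1) ^ n = 1 := by
    rw [← mul_pow, neg_one_mul, neg_neg, one_pow]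
  calc M.det = -(-1) ^ n * (M.det * -(-1) ^ n) := by linear_combination -M.det * hsign
    _ = _ := by
      rw [hdet, div_eq_mul_inv]
      ring

end ScottPermanent

/-! ### Shifted factorials and the final formula -/

theorem pow_mul_shiftedFactorial_div {K : Type*} [Field K] {c : K} (hc : c ≠ 0) (T : K) (k : ℕ) :
    c ^ k * shiftedFactorial (T / c) k = ∏ j ∈ Finset.range k, (T + j * c) := by
  rw [shiftedFactorial, ← Finset.card_range k, ← Finset.prod_const, Finset.card_range,
    ← Finset.prod_mul_distrib]
  refine Finset.prod_congr rfl fun j _ => ?_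
  rw [mul_add, mul_div_cancel₀ _ hc, mul_comm c]

/-- Clearing the denominator of a shifted factorial, also when all the coefficients vanish. -/
theorem pow_mul_shiftedFactorial_sum_div {K : Type*} [Field K] [CharZero K] {m d e : ℕ}
    (hd : d ≠ 0) (he : e ≠ 0) {a t : ℕ → K}
    (h : ∑ l ∈ Finset.range (m + 1), a l ≠ 0 ∨ ∀ l ≤ m, a l = 0) :
    (d : K) ^ e * ((∑ l ∈ Finset.range (m + 1), a l) ^ e * shiftedFactorial
        ((∑ l ∈ Finset.range (m + 1), t l * a l) / ∑ l ∈ Finset.range (m + 1), (d : K) * a l) e) =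
      ∏ j ∈ Finset.range e, (∑ l ∈ Finset.range (m + 1), t l * a l +
        j * (d * ∑ l ∈ Finset.range (m + 1), a l)) := by
  rcases h with h | h
  · rw [← Finset.mul_sum, ← mul_assoc, ← mul_pow]
    exact pow_mul_shiftedFactorial_div (mul_ne_zero (Nat.cast_ne_zero.2 hd) h) _ _
  · have h0 : ∀ c : ℕ → K, ∑ l ∈ Finset.range (m + 1), c l * a l = 0 := fun c =>
      Finset.sum_eq_zero fun l hl => by
        rw [h l (Nat.lt_succ_iff.1 (Finset.mem_range.1 hl)), mul_zero]
    have h1 : ∑ l ∈ Finset.range (m + 1), a l = 0 := by simpa using h0 1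
    rw [h1, h0, zero_pow he]
    simp [zero_pow he]

theorem theorem10 {K : Type*} [Field K] [IsAlgClosed K] [CharZero K]
    (n m r d : ℕ) (hn : 0 < n) (hm : 0 < m) (hr : 0 < r) (hd : d = Nat.gcd n r)
    (a b : ℕ → K) (A B : K)
    (hA : A = ∑ l ∈ Finset.range (m + 1), a l)
    (hB : B = ∑ l ∈ Finset.range (m + 1), b l)
    -- no zero of `x ^ n - 1` is a zero of `Q`, so that all the entries `1 / (x_i - y_j)` exist
    (hPQ : ∀ z : K, z ^ n = 1 → (twoClassPoly n m r a b).eval z ≠ 0) :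
    -- the denominator of the formula does not vanish
    (A ^ (n / d) - (-B) ^ (n / d)) ^ d ≠ 0 ∧
    -- the formula with shifted factorials, where a term with a zero sum in the denominator
    -- inside a shifted factorial is present only if all its coefficients vanish (the term is 0)
    ((A ≠ 0 ∨ ∀ l ≤ m, a l = 0) → (B ≠ 0 ∨ ∀ l ≤ m, b l = 0) →
      scottPermanent (X ^ n - 1) (twoClassPoly n m r a b) =
        -(((d : K) ^ n * ∏ i ∈ Finset.Icc 1 d,
            (A ^ (n / d) *
                shiftedFactorial
                  ((∑ l ∈ Finset.range (m + 1), ((i : K) - (n : K) * (l : K) - 1) * a l) /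
                    ∑ l ∈ Finset.range (m + 1), (d : K) * a l) (n / d) -
              (-B) ^ (n / d) *
                shiftedFactorial
                  ((∑ l ∈ Finset.range (m + 1),
                      ((i : K) - (r : K) - (n : K) * (l : K) - 1) * b l) /
                    ∑ l ∈ Finset.range (m + 1), (d : K) * b l) (n / d))) /
          (A ^ (n / d) - (-B) ^ (n / d)) ^ d)) ∧
    -- the formula in general: `d ^ k * A ^ k * (T / (d * A))_k` is read as the product
    -- `T * (T + d * A) * ⋯ * (T + (k - 1) * d * A)`, which makes sense for `A = 0` too
    scottPermanent (X ^ n - 1) (twoClassPoly n m r a b) =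
      -((∏ i ∈ Finset.Icc 1 d,
          (∏ j ∈ Finset.range (n / d),
              ((∑ l ∈ Finset.range (m + 1), ((i : K) - (n : K) * (l : K) - 1) * a l) +
                (j : K) * ((d : K) * A)) -
            (-1) ^ (n / d) * ∏ j ∈ Finset.range (n / d),
              ((∑ l ∈ Finset.range (m + 1),
                  ((i : K) - (r : K) - (n : K) * (l : K) - 1) * b l) +
                (j : K) * ((d : K) * B)))) /
        (A ^ (n / d) - (-B) ^ (n / d)) ^ d) := by
  subst hd
  have : NeZero n := ⟨hn.ne'⟩
  set d := n.gcd r with hd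
  set e := n / d with he
  have hd0 : d ≠ 0 := (Nat.gcd_pos_of_pos_left _ hn).ne'
  have hde : d * e = n := Nat.mul_div_cancel' (Nat.gcd_dvd_left n r)
  have he0 : e ≠ 0 := fun h => by
    rw [h, mul_zero] at hde
    omega
  obtain ⟨hden, hper⟩ := scottPermanent_twoClassPoly hA hB hPQ
  rw [← hd, ← he] at hden hper
  have hgen : scottPermanent (X ^ n - 1) (twoClassPoly n m r a b) =
      -((∏ i ∈ Finset.Icc 1 d,
          (∏ j ∈ Finset.range e,
              ((∑ l ∈ Finset.range (m + 1), ((i : K) - (n : K) * (l : K) - 1) * a l) +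
                (j : K) * ((d : K) * A)) -
            (-1) ^ e * ∏ j ∈ Finset.range e,
              ((∑ l ∈ Finset.range (m + 1),
                  ((i : K) - (r : K) - (n : K) * (l : K) - 1) * b l) +
                (j : K) * ((d : K) * B)))) /
        (A ^ e - (-B) ^ e) ^ d) := by
    rw [hper, neg_div]
    congr 2
    -- The sign `(-1)^n` is shared out as `(-1)^e` to each of the `d` factors, negating every `α_k`
    -- and `β_k`. The index `i` moves from `0, …, d - 1` to `1, …, d`, whence the `- 1` in the
    -- formula.
    have hpow : (-1 : K) ^ n = ∏ i ∈ Finset.range d, (-1) ^ e := by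
      rw [Finset.prod_const, Finset.card_range, ← pow_mul, mul_comm e, hde]
    rw [← Finset.Ico_add_one_right_eq_Icc, Finset.prod_Ico_eq_prod_range, Nat.add_sub_cancel, hpow,
      ← Finset.prod_mul_distrib]
    refine Finset.prod_congr rfl fun i _ => ?_
    have hneg : ∀ f : ℕ → K, ∏ j ∈ Finset.range e, -f j = (-1) ^ e * ∏ j ∈ Finset.range e, f j :=
      fun f => by rw [Finset.prod_neg, Finset.card_range]
    rw [mul_sub, mul_left_comm _ ((-1) ^ e), ← hneg, ← hneg]
    congr 1
    · refine Finset.prod_congr rfl fun j _ => ?_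
      rw [hA, Finset.mul_sum, Finset.mul_sum, ← Finset.sum_neg_distrib, ← Finset.sum_add_distrib]
      refine Finset.sum_congr rfl fun l _ => ?_
      push_cast
      ring
    · congr 1
      refine Finset.prod_congr rfl fun j _ => ?_
      rw [hB, Finset.mul_sum, Finset.mul_sum, ← Finset.sum_neg_distrib, ← Finset.sum_add_distrib]
      refine Finset.sum_congr rfl fun l _ => ?_
      push_cast
      ring
  refine ⟨hden, fun ha hb => ?_, hgen⟩
  rw [hgen]
  congr 2
  have hpow : (d : K) ^ n = ∏ i ∈ Finset.Icc 1 d, (d : K) ^ e := by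
    rw [Finset.prod_const, Nat.card_Icc, Nat.add_sub_cancel, ← pow_mul, mul_comm e, hde]
  rw [hpow, ← Finset.prod_mul_distrib]
  refine Finset.prod_congr rfl fun i _ => ?_
  rw [mul_sub, neg_pow B, mul_assoc ((-1) ^ e), mul_left_comm _ ((-1) ^ e), hA, hB,
    pow_mul_shiftedFactorial_sum_div hd0 he0 (hA ▸ ha),
    pow_mul_shiftedFactorial_sum_div hd0 he0 (hB ▸ hb)]
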